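/- For a measurable real function $x$ on $[0,1]$ (with Lebesgue measure $\mathrm{mes}$) let $x^*(t)=\inf\{s\ge 0:\mathrm{mes}\{|x|>s\}\le t\}$ be the decreasing rearrangement of $|x|$. A rearrangement invariant (r.i.) space on $[0,1]$ is a Banach space $E$ of (classes of a.e. equal) measurable real functions on $[0,1]$, containing the constants, such that $y\in E$ and $x^*\le y^*$ imply $x\in E$ and $\|x\|_E\le\|y\|_E$. For a real matrix $x=(x_{ij})_{1\le i,j\le n}$, let $x_1^*\ge x_2^*\ge\dots\ge x_{n^2}^*$ be the numbers $|x_{ij}|$ arranged in decreasing order, and put $$Ux(t)=\sum_{k=1}^n x_k^*\,\chi_{((k-1)/n,\,k/n)}(t),\qquad t\in[0,1].$$ For $1\le q<\infty$ and a bijection $\ell$ from the symmetric group $S_n$ onto $\{1,\dots,n!\}$ put $$T_qx(t)=\Bigl(\sum_{i=1}^n|x_{i,\pi(i)}|^q\Bigr)^{1/q},\qquad t\in\Bigl[\frac{\ell(\pi)-1}{n!},\frac{\ell(\pi)}{n!}\Bigr),\ \pi\in S_n .$$ Theorem 13. Let $E$ be an r.i. space with $E\supset L_p[0,1]$ for some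 $0<p<\infty$, and let $1\le q<\infty$. Then $E\in F_q$, that is, there are constants $c,C>0$ such that for every $n\ge 1$, every real $n\times n$ matrix $x$ and every bijection $\ell$ as above, the functions $T_qx$ and $Ux$ belong to $E$ and $$c\,\Bigl(\|Ux\|_E+\Bigl(\frac1n\sum_{k=n+1}^{n^2}(x_k^*)^q\Bigr)^{1/q}\Bigr)\le\|T_qx\|_E\le C\,\Bigl(\|Ux\|_E+\Bigl(\frac1n\sum_{k=n+1}^{n^2}(x_k^*)^q\Bigr)^{1/q}\Bigr).$$ -/

import Mathlib

open MeasureTheory Filter Topology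
open scoped ENNReal

noncomputable section

namespace RI

/-- Lebesgue measure on `[0,1]`. -/
abbrev lam : Measure ℝ := volume.restrict (Set.Icc (0 : ℝ) 1)

/-- Almost-everywhere classes of real measurable functions on `[0,1]`. -/
abbrev L0 : Type := ℝ →ₘ[lam] ℝ

/-- The decreasing rearrangement `x*` of `|x|`, with values in `[0,∞]`:
`x*(t) = inf {s ≥ 0 : mes {|x| > s} ≤ t}`. (The value `∞` can occur only at `t = 0`.) -/
def rearr (x : L0) (t : ℝ) : ℝ≥0∞ :=
  sInf {s : ℝ≥0∞ | lam {u | s < ‖x u‖ₑ} ≤ ENNReal.ofReal t}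

/-- A rearrangement invariant space on `[0,1]`: a Banach space `E` of (classes of) measurable
functions on `[0,1]`, containing the constants, such that `y ∈ E` and `x* ≤ y*` imply `x ∈ E`
and `‖x‖_E ≤ ‖y‖_E`. The function `norm` is meaningful on `carrier` only. -/
structure RISpace where
  /-- the underlying linear space -/
  carrier : Submodule ℝ L0
  /-- the norm of `E`, on elements of `carrier` -/
  norm : L0 → ℝ
  norm_add_le : ∀ x ∈ carrier, ∀ y ∈ carrier, norm (x + y) ≤ norm x + norm y
  norm_smul : ∀ (c : ℝ), ∀ x ∈ carrier, norm (c • x) = |c| * norm x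
  eq_zero_of_norm : ∀ x ∈ carrier, norm x = 0 → x = 0
  complete : ∀ u : ℕ → L0, (∀ k, u k ∈ carrier) →
    (∀ ε : ℝ, 0 < ε → ∃ N : ℕ, ∀ k ≥ N, ∀ m ≥ N, norm (u k - u m) < ε) →
    ∃ v ∈ carrier, Tendsto (fun k => norm (u k - v)) atTop (𝓝 0)
  one_mem : (1 : L0) ∈ carrier
  rearr_le : ∀ y ∈ carrier, ∀ x : L0, (∀ t ∈ Set.Icc (0 : ℝ) 1, rearr x t ≤ rearr y t) →
    x ∈ carrier ∧ norm x ≤ norm y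

/-- `x*_k` for `k = 1, …, n²`: the `k`-th term of the list of all `|x_{ij}|`, arranged in
decreasing order with multiplicities. -/
def entryRearr {n : ℕ} (x : Matrix (Fin n) (Fin n) ℝ) (k : ℕ) : ℝ :=
  (((Finset.univ : Finset (Fin n × Fin n)).val.map fun ij => |x ij.1 ij.2|).sort
    (fun a b => b ≤ a)).getD (k - 1) 0

/-- The step function `T_q x`, for an enumeration `ℓ` of `S_n` by `0, …, n! - 1`: it equals
`(∑ᵢ |x_{i,π(i)}|^q)^{1/q}` on `[ℓ(π)/n!, (ℓ(π)+1)/n!)`, for every permutation `π`. -/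
def T (q : ℝ) {n : ℕ} (ℓ : Equiv.Perm (Fin n) ≃ Fin n.factorial)
    (x : Matrix (Fin n) (Fin n) ℝ) (t : ℝ) : ℝ :=
  ∑ π : Equiv.Perm (Fin n),
    (Set.Ico (((ℓ π : ℕ) : ℝ) / n.factorial) ((((ℓ π : ℕ) : ℝ) + 1) / n.factorial)).indicator
      (fun _ => (∑ i, |x i (π i)| ^ q) ^ (1 / q)) t

/-- The step function `U x = ∑_{k=1}^n x*_k χ_{((k-1)/n, k/n)}`. -/
def U {n : ℕ} (x : Matrix (Fin n) (Fin n) ℝ) (t : ℝ) : ℝ :=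
  ∑ k ∈ Finset.Icc 1 n,
    (Set.Ioo (((k : ℝ) - 1) / n) ((k : ℝ) / n)).indicator (fun _ => entryRearr x k) t

/-- The tail term `((1/n) ∑_{k=n+1}^{n²} (x*_k)^q)^{1/q}`. -/
def tail (q : ℝ) {n : ℕ} (x : Matrix (Fin n) (Fin n) ℝ) : ℝ :=
  ((1 / (n : ℝ)) * ∑ k ∈ Finset.Icc (n + 1) (n ^ 2), entryRearr x k ^ q) ^ (1 / q)

theorem measurable_T (q : ℝ) {n : ℕ} (ℓ : Equiv.Perm (Fin n) ≃ Fin n.factorial)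
    (x : Matrix (Fin n) (Fin n) ℝ) : Measurable (T q ℓ x) :=
  Finset.measurable_fun_sum _ fun _ _ => measurable_const.indicator measurableSet_Ico

theorem measurable_U {n : ℕ} (x : Matrix (Fin n) (Fin n) ℝ) : Measurable (U x) :=
  Finset.measurable_fun_sum _ fun _ _ => measurable_const.indicator measurableSet_Ioo

/-- `T_q x` as an element of `L0`. -/
def Tcls (q : ℝ) {n : ℕ} (ℓ : Equiv.Perm (Fin n) ≃ Fin n.factorial)
    (x : Matrix (Fin n) (Fin n) ℝ) : L0 :=
  AEEqFun.mk (T q ℓ x) (measurable_T q ℓ x).aestronglyMeasurable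

/-- `U x` as an element of `L0`. -/
def Ucls {n : ℕ} (x : Matrix (Fin n) (Fin n) ℝ) : L0 :=
  AEEqFun.mk (U x) (measurable_U x).aestronglyMeasurable

/-- The class `F_q` of r.i. spaces `E` for which
`‖T_q x‖_E ≈ ‖U x‖_E + ((1/n) ∑_{k=n+1}^{n²} (x*_k)^q)^{1/q}`, with constants that depend
neither on the matrix `x`, nor on its size `n`, nor on the enumeration of `S_n`. -/
def F (q : ℝ) : Set RISpace :=
  {E | ∃ c C : ℝ, 0 < c ∧ 0 < C ∧
    ∀ (n : ℕ), 1 ≤ n → ∀ (ℓ : Equiv.Perm (Fin n) ≃ Fin n.factorial)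
      (x : Matrix (Fin n) (Fin n) ℝ),
      Tcls q ℓ x ∈ E.carrier ∧ Ucls x ∈ E.carrier ∧
      c * (E.norm (Ucls x) + tail q x) ≤ E.norm (Tcls q ℓ x) ∧
      E.norm (Tcls q ℓ x) ≤ C * (E.norm (Ucls x) + tail q x)}

end RI

end

/-! For a uniformly random permutation π, `T q ℓ x` is distributed as the ℓ_q norm of the entries
x_{i,π(i)}. The engine is the size-bias inequality `sum_diagSum_mul_le`: if 0 ≤ y ≤ M, S = ∑
y_{i,π(i)} and f is increasing, then E[S f(S)] ≤ E[S] E[f(S + 2M)]. Constant f gives E[S]; f = id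
gives the second moment and with it Paley-Zygmund (`card_lt_diagSum_ge`); products of shifted
positive parts give factorial moments and a tail bound (`card_lt_diagSum_le`).

Let M = x*_n. Lower estimate: π meets an entry above s with probability at least a third of mes{Ux >
s} (`card_sortedEntry_le`), and the matrix min(|x|, M)^q has mean M^q + tail^q, which dominates its
entries, so its sum along π exceeds half the mean with probability at least 1/12
(`factorial_le_card_permNorm`). A loss of a factor N in probability costs a factor N in norm, by
dilation (`stepCls_div_mem_and_norm_le`).

Upper estimate: for each t in (0,1), outside an event of probability at most t, the norm is at most
2m times a dilate of Ux at t plus K t^{-1/m}, where K is a combination of the mean of Ux and the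
tail (`card_lt_permNorm_le`). Such a quantile bound is domination in distribution
(`lam_lt_le_of_quantile`). For m > p the power lies in L_p, hence in E; this is where E ⊃ L_p
enters. The mean of Ux is absorbed by its norm (`sum_mul_norm_one_le`). -/

namespace RI

open Equiv

/-! ### Moments and tails of sums along a random permutation -/

section Permutations

variable {n : ℕ}

/-- The sum of the matrix `y` along the graph of a permutation. -/
def diagSum (y : Fin n → Fin n → ℝ) (π : Perm (Fin n)) : ℝ := ∑ i, y i (π i)

/-- The expectation of `diagSum y π` for a uniformly distributed permutation `π`. -/
noncomputable def mean (y : Fin n → Fin n → ℝ) : ℝ := (∑ i, ∑ j, y i j) / n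

theorem diagSum_nonneg {y : Fin n → Fin n → ℝ} (h0 : ∀ i j, 0 ≤ y i j) (π : Perm (Fin n)) :
    0 ≤ diagSum y π := Finset.sum_nonneg fun _ _ => h0 _ _

theorem mean_nonneg {y : Fin n → Fin n → ℝ} (h0 : ∀ i j, 0 ≤ y i j) : 0 ≤ mean y :=
  div_nonneg (Finset.sum_nonneg fun _ _ => Finset.sum_nonneg fun _ _ => h0 _ _) n.cast_nonneg

theorem diagSum_swap_mul_le {y : Fin n → Fin n → ℝ} {M : ℝ} (h0 : ∀ i j, 0 ≤ y i j)
    (hM : ∀ i j, y i j ≤ M) (π : Perm (Fin n)) (j k : Fin n) :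
    diagSum y (swap k j * π) ≤ diagSum y π + 2 * M := by
  -- The swap affects only the rows that π sends to j or k, and there the new entry is at most M.
  have key : ∀ i, y i ((swap k j * π) i) ≤
      y i (π i) + ((if π i = k then M else 0) + (if π i = j then M else 0)) := by
    intro i
    have hM0 : 0 ≤ M := (h0 i i).trans (hM i i)
    have := h0 i (π i)
    rw [Perm.mul_apply]
    by_cases h1 : π i = k
    · have := hM i (swap k j (π i))
      rw [if_pos h1]
      split_ifs <;> linarith
    · by_cases h2 : π i = j
      · have := hM i (swap k j (π i))
        rw [if_neg h1, if_pos h2]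
        linarith
      · rw [swap_apply_of_ne_of_ne h1 h2, if_neg h1, if_neg h2]
        linarith
  have sum_ite : ∀ k, ∑ i, (if π i = k then M else 0) = M := by
    intro k
    rw [Equiv.sum_comp π (fun i => if i = k then M else 0)]
    simp
  calc diagSum y (swap k j * π)
      ≤ ∑ i, (y i (π i) + ((if π i = k then M else 0) + (if π i = j then M else 0))) :=
        Finset.sum_le_sum fun i _ => key i
    _ = diagSum y π + 2 * M := by
        rw [Finset.sum_add_distrib, Finset.sum_add_distrib, sum_ite, sum_ite, diagSum]
        ring

/-- Left multiplication by `swap k j` maps {π i = k} bijectively onto {π i = j} and raises the sum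
by at most 2M. Summing over all k removes the conditioning on π i. -/
theorem sum_fiber_le {y : Fin n → Fin n → ℝ} {M : ℝ} (h0 : ∀ i j, 0 ≤ y i j)
    (hM : ∀ i j, y i j ≤ M) {f : ℝ → ℝ} (hf : Monotone f) (i j : Fin n) :
    n * ∑ π : Perm (Fin n), (if π i = j then f (diagSum y π) else 0) ≤
      ∑ π : Perm (Fin n), f (diagSum y π + 2 * M) := by
  have key : ∀ k : Fin n, ∑ π : Perm (Fin n), (if π i = j then f (diagSum y π) else 0) ≤
      ∑ π : Perm (Fin n), (if π i = k then f (diagSum y π + 2 * M) else 0) := by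
    intro k
    rw [← Equiv.sum_comp (Equiv.mulLeft (swap k j))
      (fun π : Perm (Fin n) => if π i = j then f (diagSum y π) else 0)]
    refine Finset.sum_le_sum fun π _ => ?_
    have hiff : (swap k j * π) i = j ↔ π i = k := by
      rw [Perm.mul_apply, ← Equiv.eq_symm_apply, symm_swap, swap_apply_right]
    simp only [coe_mulLeft, hiff]
    split_ifs
    · exact hf (diagSum_swap_mul_le h0 hM π j k)
    · exact le_rfl
  calc n * ∑ π : Perm (Fin n), (if π i = j then f (diagSum y π) else 0)
      = ∑ _k : Fin n, ∑ π : Perm (Fin n), (if π i = j then f (diagSum y π) else 0) := by simp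
    _ ≤ ∑ k : Fin n, ∑ π : Perm (Fin n), (if π i = k then f (diagSum y π + 2 * M) else 0) :=
        Finset.sum_le_sum fun k _ => key k
    _ = ∑ π : Perm (Fin n), f (diagSum y π + 2 * M) := by
        rw [Finset.sum_comm]
        simp

/-- The size-bias inequality for sums along random permutations. -/
theorem sum_diagSum_mul_le (hn : 1 ≤ n) {y : Fin n → Fin n → ℝ} {M : ℝ} (h0 : ∀ i j, 0 ≤ y i j)
    (hM : ∀ i j, y i j ≤ M) {f : ℝ → ℝ} (hf : Monotone f) :
    ∑ π : Perm (Fin n), diagSum y π * f (diagSum y π) ≤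
      mean y * ∑ π : Perm (Fin n), f (diagSum y π + 2 * M) := by
  have hn' : (0 : ℝ) < n := by exact_mod_cast hn
  have expand : ∑ π : Perm (Fin n), diagSum y π * f (diagSum y π) =
      ∑ i, ∑ j, y i j * ∑ π : Perm (Fin n), (if π i = j then f (diagSum y π) else 0) := by
    calc ∑ π : Perm (Fin n), diagSum y π * f (diagSum y π)
        = ∑ π : Perm (Fin n), ∑ i, ∑ j, y i j * (if π i = j then f (diagSum y π) else 0) := by
          refine Finset.sum_congr rfl fun π _ => ?_
          rw [show diagSum y π * f (diagSum y π) = (∑ i, y i (π i)) * f (diagSum y π) from rfl,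
            Finset.sum_mul]
          simp
      _ = _ := by
          rw [Finset.sum_comm]
          refine Finset.sum_congr rfl fun i _ => ?_
          rw [Finset.sum_comm]
          exact Finset.sum_congr rfl fun j _ => (Finset.mul_sum _ _ _).symm
  rw [expand, mean, div_mul_eq_mul_div, le_div_iff₀ hn', Finset.sum_mul, Finset.sum_mul]
  refine Finset.sum_le_sum fun i _ => ?_
  rw [Finset.sum_mul, Finset.sum_mul]
  refine Finset.sum_le_sum fun j _ => ?_
  rw [mul_assoc, mul_comm _ (n : ℝ)]
  exact mul_le_mul_of_nonneg_left (sum_fiber_le h0 hM hf i j) (h0 i j)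

theorem sum_diagSum (hn : 1 ≤ n) {y : Fin n → Fin n → ℝ} (h0 : ∀ i j, 0 ≤ y i j) :
    ∑ π : Perm (Fin n), diagSum y π = n.factorial * mean y := by
  have hM : ∀ i j, y i j ≤ ∑ i, ∑ j, y i j := fun i j =>
    (Finset.single_le_sum (fun j _ => h0 i j) (Finset.mem_univ j)).trans
      (Finset.single_le_sum (f := fun i => ∑ j, y i j)
        (fun i _ => Finset.sum_nonneg fun j _ => h0 i j) (Finset.mem_univ i))
  -- Both constants 1 and -1 are monotone, so the one-sided inequality yields an equality; the bound
  -- on the entries plays no role in its value.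
  have h1 := sum_diagSum_mul_le hn h0 hM (f := fun _ => 1) monotone_const
  have h2 := sum_diagSum_mul_le hn h0 hM (f := fun _ => -1) monotone_const
  simp only [mul_one, mul_neg, Finset.sum_neg_distrib, Finset.sum_const, Finset.card_univ,
    Fintype.card_perm, Fintype.card_fin, nsmul_eq_mul] at h1 h2
  linarith

theorem sum_diagSum_sq_le (hn : 1 ≤ n) {y : Fin n → Fin n → ℝ} {M : ℝ} (h0 : ∀ i j, 0 ≤ y i j)
    (hM : ∀ i j, y i j ≤ M) :
    ∑ π : Perm (Fin n), diagSum y π ^ 2 ≤ n.factorial * (mean y * (mean y + 2 * M)) := by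
  have h := sum_diagSum_mul_le hn h0 hM (f := id) monotone_id
  simp only [id, Finset.sum_add_distrib, sum_diagSum hn h0, Finset.sum_const, Finset.card_univ,
    Fintype.card_perm, Fintype.card_fin, nsmul_eq_mul] at h
  simp only [sq]
  linarith

/-- Paley-Zygmund inequality for sums along random permutations. -/
theorem card_lt_diagSum_ge (hn : 1 ≤ n) {y : Fin n → Fin n → ℝ} {M θ : ℝ}
    (h0 : ∀ i j, 0 ≤ y i j) (hM : ∀ i j, y i j ≤ M) (hθ : 0 ≤ θ) (hθ' : θ ≤ mean y) :
    n.factorial * (mean y - θ) ^ 2 ≤ mean y * (mean y + 2 * M) *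
      (Finset.univ.filter fun π : Perm (Fin n) => θ < diagSum y π).card := by
  set A := Finset.univ.filter fun π : Perm (Fin n) => θ < diagSum y π with hA
  have hfac : (0 : ℝ) < n.factorial := by exact_mod_cast n.factorial_pos
  have h1 : n.factorial * (mean y - θ) ≤ ∑ π ∈ A, diagSum y π := by
    have h2 : ∑ π : Perm (Fin n), (diagSum y π - θ) ≤ ∑ π ∈ A, diagSum y π := by
      rw [hA, Finset.sum_filter]
      refine Finset.sum_le_sum fun π _ => ?_
      split_ifs with h <;> linarith
    simp only [Finset.sum_sub_distrib, sum_diagSum hn h0, Finset.sum_const, Finset.card_univ,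
      Fintype.card_perm, Fintype.card_fin, nsmul_eq_mul] at h2
    linarith
  -- Cauchy-Schwarz on the event A.
  have h3 : (∑ π ∈ A, diagSum y π) ^ 2 ≤ A.card * ∑ π ∈ A, diagSum y π ^ 2 :=
    sq_sum_le_card_mul_sum_sq
  have h4 : ∑ π ∈ A, diagSum y π ^ 2 ≤ n.factorial * (mean y * (mean y + 2 * M)) :=
    (Finset.sum_le_univ_sum_of_nonneg fun _ => sq_nonneg _).trans (sum_diagSum_sq_le hn h0 hM)
  have h5 : (n.factorial * (mean y - θ)) ^ 2 ≤
      A.card * (n.factorial * (mean y * (mean y + 2 * M))) :=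
    ((pow_le_pow_left₀ (mul_nonneg hfac.le (by linarith)) h1 2).trans h3).trans
      (mul_le_mul_of_nonneg_left h4 (Nat.cast_nonneg _))
  refine le_of_mul_le_mul_left ?_ hfac
  linarith

/-- A factorial moment with step 2M. The factor k = 0 is S itself and the others form an increasing
function of S, so size bias replaces S by S + 2M there, which lowers every shift by one step and
gives the induction. -/
theorem sum_prod_diagSum_le (hn : 1 ≤ n) {y : Fin n → Fin n → ℝ} {M : ℝ}
    (h0 : ∀ i j, 0 ≤ y i j) (hM : ∀ i j, y i j ≤ M) (m : ℕ) :
    ∑ π : Perm (Fin n), ∏ k ∈ Finset.range m, max (diagSum y π - 2 * k * M) 0 ≤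
      n.factorial * mean y ^ m := by
  induction m with
  | zero => simp [Fintype.card_perm]
  | succ m ih =>
    have hf : Monotone fun s : ℝ => ∏ k ∈ Finset.range m, max (s - 2 * ((k + 1 : ℕ) : ℝ) * M) 0 :=
      fun s t hst => Finset.prod_le_prod (fun _ _ => le_max_right _ _)
        fun k _ => max_le_max_right _ (by linarith)
    calc ∑ π : Perm (Fin n), ∏ k ∈ Finset.range (m + 1), max (diagSum y π - 2 * k * M) 0
        = ∑ π : Perm (Fin n), diagSum y π *
            ∏ k ∈ Finset.range m, max (diagSum y π - 2 * ((k + 1 : ℕ) : ℝ) * M) 0 := by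
          refine Finset.sum_congr rfl fun π _ => ?_
          rw [Finset.prod_range_succ', mul_comm]
          simp [max_eq_left (diagSum_nonneg h0 π)]
      _ ≤ mean y * ∑ π : Perm (Fin n),
            ∏ k ∈ Finset.range m, max (diagSum y π + 2 * M - 2 * ((k + 1 : ℕ) : ℝ) * M) 0 :=
          sum_diagSum_mul_le hn h0 hM hf
      _ = mean y * ∑ π : Perm (Fin n),
            ∏ k ∈ Finset.range m, max (diagSum y π - 2 * k * M) 0 := by
          congr 1
          refine Finset.sum_congr rfl fun π _ => Finset.prod_congr rfl fun k _ => ?_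
          congr 1
          push_cast
          ring
      _ ≤ mean y * (n.factorial * mean y ^ m) := mul_le_mul_of_nonneg_left ih (mean_nonneg h0)
      _ = n.factorial * mean y ^ (m + 1) := by ring

/-- A Bennett-type tail bound for sums along random permutations. -/
theorem card_lt_diagSum_le (hn : 1 ≤ n) {y : Fin n → Fin n → ℝ} {M b B : ℝ}
    (h0 : ∀ i j, 0 ≤ y i j) (hM0 : 0 ≤ M) (hM : ∀ i j, y i j ≤ M) (hb : mean y ≤ b) (hB : 0 ≤ B)
    (m : ℕ) :
    (Finset.univ.filter fun π : Perm (Fin n) => 2 * m * M + b * B < diagSum y π).card * B ^ m ≤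
      n.factorial := by
  set A := Finset.univ.filter fun π : Perm (Fin n) => 2 * m * M + b * B < diagSum y π with hA
  have hb0 : 0 ≤ b := (mean_nonneg h0).trans hb
  have hmM : 0 ≤ 2 * m * M := by positivity
  -- The case b = 0 is separate because b ^ m is cancelled at the end; there all the sums vanish.
  rcases hb0.eq_or_lt with rfl | hbpos
  · have hsum : ∑ π : Perm (Fin n), diagSum y π = 0 := by
      rw [sum_diagSum hn h0, le_antisymm hb (mean_nonneg h0), mul_zero]
    have hz := (Finset.sum_eq_zero_iff_of_nonneg fun π _ => diagSum_nonneg h0 π).1 hsum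
    have : A = ∅ := Finset.filter_eq_empty_iff.2 fun π hπ => by
      rw [hz π hπ]
      linarith
    simp [this]
  -- Markov's inequality for the factorial moment: on A each of the m factors is at least b * B.
  · have h1 : A.card * (b * B) ^ m ≤ n.factorial * b ^ m := by
      calc A.card * (b * B) ^ m = ∑ _π ∈ A, (b * B) ^ m := by simp
        _ ≤ ∑ π ∈ A, ∏ k ∈ Finset.range m, max (diagSum y π - 2 * k * M) 0 := by
            refine Finset.sum_le_sum fun π hπ => ?_
            have hπ' := (Finset.mem_filter.1 hπ).2
            calc (b * B) ^ m = ∏ _k ∈ Finset.range m, (b * B) := by simp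
              _ ≤ _ := by
                refine Finset.prod_le_prod (fun _ _ => by positivity) fun k hk => ?_
                have hkm : (k : ℝ) ≤ m := by exact_mod_cast (Finset.mem_range.1 hk).le
                have : 2 * (k : ℝ) * M ≤ 2 * m * M := by gcongr
                exact le_max_of_le_left (by linarith)
        _ ≤ ∑ π : Perm (Fin n), ∏ k ∈ Finset.range m, max (diagSum y π - 2 * k * M) 0 :=
            Finset.sum_le_univ_sum_of_nonneg fun _ =>
              Finset.prod_nonneg fun _ _ => le_max_right _ _
        _ ≤ n.factorial * mean y ^ m := sum_prod_diagSum_le hn h0 hM m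
        _ ≤ n.factorial * b ^ m := by
            gcongr
            exact mean_nonneg h0
    rw [mul_pow] at h1
    refine le_of_mul_le_mul_left ?_ (pow_pos hbpos m)
    linarith

/-- The union bound for the event that a random permutation meets a given set of positions. -/
theorem card_exists_le (P : Fin n → Fin n → Prop) [∀ i j, Decidable (P i j)] (hn : 1 ≤ n) :
    n * ((Finset.univ.filter fun π : Perm (Fin n) => ∃ i, P i (π i)).card : ℝ) ≤
      n.factorial * (Finset.univ.filter fun ij : Fin n × Fin n => P ij.1 ij.2).card := by
  have hn' : (n : ℝ) ≠ 0 := by exact_mod_cast (by omega : n ≠ 0)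
  set y : Fin n → Fin n → ℝ := fun i j => if P i j then 1 else 0 with hy
  have h0 : ∀ i j, 0 ≤ y i j := fun i j => by simp only [hy]; split_ifs <;> norm_num
  have hmean : n * mean y =
      ((Finset.univ.filter fun ij : Fin n × Fin n => P ij.1 ij.2).card : ℝ) := by
    rw [mean, mul_div_cancel₀ _ hn', ← Fintype.sum_prod_type']
    simp [hy]
  have h1 : ((Finset.univ.filter fun π : Perm (Fin n) => ∃ i, P i (π i)).card : ℝ) ≤
      n.factorial * mean y := by
    rw [← sum_diagSum hn h0, Finset.card_filter]
    push_cast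
    refine Finset.sum_le_sum fun π _ => ?_
    split_ifs with h
    · obtain ⟨i, hi⟩ := h
      refine le_trans ?_ (Finset.single_le_sum (f := fun i => y i (π i)) (fun i _ => h0 _ _)
        (Finset.mem_univ i))
      simp [hy, hi]
    · exact diagSum_nonneg h0 π
  rw [← hmean, mul_left_comm]
  exact mul_le_mul_of_nonneg_left h1 n.cast_nonneg

end Permutations

/-! ### The decreasing arrangement of the entries -/

section SortedEntries

variable {n : ℕ} (x : Matrix (Fin n) (Fin n) ℝ)

/-- The decreasing arrangement of the numbers `|x i j|`, indexed from `0` and extended by `0`. -/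
noncomputable def sortedEntry (k : ℕ) : ℝ := entryRearr x (k + 1)

theorem exists_list_sortedEntry : ∃ L : List ℝ, L.Pairwise (fun a b => b ≤ a) ∧
    (L : Multiset ℝ) = (Finset.univ : Finset (Fin n × Fin n)).val.map (fun ij => |x ij.1 ij.2|) ∧
    ∀ k, sortedEntry x k = L.getD k 0 :=
  ⟨_, Multiset.pairwise_sort _ _, Multiset.sort_eq _ _, fun _ => rfl⟩

theorem sortedEntry_nonneg (k : ℕ) : 0 ≤ sortedEntry x k := by
  obtain ⟨L, -, hL, h⟩ := exists_list_sortedEntry x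
  rw [h]
  by_cases hk : k < L.length
  · rw [List.getD_eq_getElem _ _ hk]
    have : L[k] ∈ (L : Multiset ℝ) := Multiset.mem_coe.2 (List.getElem_mem hk)
    rw [hL, Multiset.mem_map] at this
    obtain ⟨ij, -, hij⟩ := this
    exact hij ▸ abs_nonneg _
  · rw [List.getD_eq_default _ _ (not_lt.1 hk)]

theorem antitone_sortedEntry : Antitone (sortedEntry x) := by
  intro k l hkl
  rcases hkl.eq_or_lt with rfl | hlt
  · exact le_rfl
  by_cases hl : l < (exists_list_sortedEntry x).choose.length
  · obtain ⟨hs, -, h⟩ := (exists_list_sortedEntry x).choose_spec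
    rw [h, h, List.getD_eq_getElem _ _ hl, List.getD_eq_getElem _ _ (hlt.trans hl)]
    exact List.pairwise_iff_getElem.1 hs k l _ _ hlt
  · obtain ⟨-, -, h⟩ := (exists_list_sortedEntry x).choose_spec
    rw [h l, List.getD_eq_default _ _ (not_lt.1 hl)]
    exact sortedEntry_nonneg x k

theorem sum_entries (φ : ℝ → ℝ) :
    ∑ i, ∑ j, φ |x i j| = ∑ k ∈ Finset.range (n ^ 2), φ (sortedEntry x k) := by
  obtain ⟨L, -, hL, h⟩ := exists_list_sortedEntry x
  have hlen : L.length = n ^ 2 := by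
    have := congrArg Multiset.card hL
    simpa [sq] using this
  rw [← Fintype.sum_prod_type' (f := fun i j => φ |x i j|), ← hlen, Finset.sum_range]
  calc ∑ ij : Fin n × Fin n, φ |x ij.1 ij.2|
      = (((Finset.univ : Finset (Fin n × Fin n)).val.map
          (fun ij => |x ij.1 ij.2|)).map φ).sum := by rw [Multiset.map_map]; rfl
    _ = (L.map φ).sum := by rw [← hL, Multiset.map_coe, Multiset.sum_coe]
    _ = ∑ k : Fin L.length, φ (sortedEntry x k) := by
        rw [← Fin.sum_univ_fun_getElem]
        exact Finset.sum_congr rfl fun k _ => by rw [h, List.getD_eq_getElem _ _ k.2]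

theorem card_entries (P : ℝ → Prop) [DecidablePred P] :
    (Finset.univ.filter fun ij : Fin n × Fin n => P |x ij.1 ij.2|).card =
      ((Finset.range (n ^ 2)).filter fun k => P (sortedEntry x k)).card := by
  have := sum_entries x fun u => if P u then 1 else 0
  rw [← Fintype.sum_prod_type' (f := fun i j => if P |x i j| then (1 : ℝ) else 0)] at this
  simpa only [Finset.sum_boole, Nat.cast_inj] using this

theorem card_sortedEntry_lt_le (k : ℕ) :
    (Finset.univ.filter fun ij : Fin n × Fin n => sortedEntry x k < |x ij.1 ij.2|).card ≤ k := by
  rw [card_entries x fun u => sortedEntry x k < u]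
  calc _ ≤ (Finset.range k).card := Finset.card_le_card fun l hl => by
        rw [Finset.mem_filter] at hl
        exact Finset.mem_range.2 (lt_of_not_ge fun h => hl.2.not_ge (antitone_sortedEntry x h))
    _ = k := Finset.card_range k

theorem tail_eq (q : ℝ) : tail q x =
    ((1 / (n : ℝ)) * ∑ k ∈ Finset.Ico n (n ^ 2), sortedEntry x k ^ q) ^ (1 / q) := by
  have : Finset.Icc (n + 1) (n ^ 2) = Finset.Ico (n + 1) (n ^ 2 + 1) := rfl
  rw [tail, this, ← Finset.sum_Ico_add' (fun k => entryRearr x k ^ q) n (n ^ 2) 1]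
  rfl

theorem tail_nonneg (q : ℝ) : 0 ≤ tail q x := by
  rw [tail_eq]
  exact Real.rpow_nonneg (mul_nonneg (by positivity) (Finset.sum_nonneg fun k _ =>
    Real.rpow_nonneg (sortedEntry_nonneg x k) q)) _

theorem tail_rpow {q : ℝ} (hq : 1 ≤ q) :
    tail q x ^ q = (∑ k ∈ Finset.Ico n (n ^ 2), sortedEntry x k ^ q) / n := by
  rw [tail_eq, ← Real.rpow_mul, one_div_mul_cancel (by linarith), Real.rpow_one,
    one_div_mul_eq_div]
  exact mul_nonneg (by positivity) (Finset.sum_nonneg fun k _ =>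
    Real.rpow_nonneg (sortedEntry_nonneg x k) q)

/-- Truncation at x*_n flattens the n largest entries to x*_n and leaves the others, which make up
the tail, unchanged. -/
theorem mean_min_sortedEntry (hn : 1 ≤ n) {q : ℝ} (hq : 1 ≤ q) :
    mean (fun i j => min |x i j| (sortedEntry x (n - 1)) ^ q) =
      sortedEntry x (n - 1) ^ q + tail q x ^ q := by
  have hn' : (n : ℝ) ≠ 0 := by exact_mod_cast (by omega : n ≠ 0)
  have hnn : n ≤ n ^ 2 := Nat.le_self_pow two_ne_zero n
  rw [mean, sum_entries x fun u => min u (sortedEntry x (n - 1)) ^ q, tail_rpow x hq,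
    ← Finset.sum_range_add_sum_Ico _ hnn, add_div]
  congr 2
  · rw [Finset.sum_congr rfl (g := fun _ => sortedEntry x (n - 1) ^ q)]
    · simp [hn']
    · intro k hk
      rw [min_eq_right (antitone_sortedEntry x (by have := Finset.mem_range.1 hk; omega))]
  · refine Finset.sum_congr rfl fun k hk => ?_
    rw [min_eq_left (antitone_sortedEntry x (by have := Finset.mem_Ico.1 hk; omega))]

/-- The integral of `U x`. -/
noncomputable def topMean : ℝ := (∑ k ∈ Finset.range n, sortedEntry x k) / n

/-- Only the n largest entries can exceed x*_n. -/
theorem mean_sub_sortedEntry_le :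
    mean (fun i j => max (|x i j| - sortedEntry x (n - 1)) 0) ≤ topMean x := by
  have hnn : n ≤ n ^ 2 := Nat.le_self_pow two_ne_zero n
  rw [mean, sum_entries x fun u => max (u - sortedEntry x (n - 1)) 0, topMean]
  refine div_le_div_of_nonneg_right ?_ n.cast_nonneg
  rw [← Finset.sum_range_add_sum_Ico _ hnn, Finset.sum_eq_zero (s := Finset.Ico _ _), add_zero]
  · exact Finset.sum_le_sum fun k _ => max_le
      (by linarith [sortedEntry_nonneg x (n - 1)]) (sortedEntry_nonneg x k)
  · intro k hk
    exact max_eq_right (sub_nonpos.2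
      (antitone_sortedEntry x (by have := Finset.mem_Ico.1 hk; omega)))

theorem sortedEntry_le_topMean (hn : 1 ≤ n) : sortedEntry x (n - 1) ≤ topMean x := by
  rw [topMean, le_div_iff₀ (by exact_mod_cast hn)]
  calc sortedEntry x (n - 1) * n = ∑ _k ∈ Finset.range n, sortedEntry x (n - 1) := by
        simp [mul_comm]
    _ ≤ _ := Finset.sum_le_sum fun k hk =>
        antitone_sortedEntry x (by have := Finset.mem_range.1 hk; omega)

end SortedEntries

/-! ### Comparison of distributions and of norms -/

section Classes

/-- The class of a measurable function. -/
noncomputable def cls (f : ℝ → ℝ) (hf : Measurable f) : L0 := AEEqFun.mk f hf.aestronglyMeasurable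

theorem lam_lt_enorm_cls {f : ℝ → ℝ} (hf : Measurable f) (s : ℝ≥0∞) :
    lam {u | s < ‖cls f hf u‖ₑ} = lam {u | s < ‖f u‖ₑ} := by
  refine measure_congr ?_
  filter_upwards [AEEqFun.coeFn_mk (μ := lam) f hf.aestronglyMeasurable] with u hu
  have : cls f hf u = f u := hu
  exact propext (by change s < _ ↔ s < _; rw [this])

/-- A smaller distribution function enlarges the set whose infimum defines the rearrangement. -/
theorem RISpace.mem_and_norm_le (E : RISpace) {f g : ℝ → ℝ} (hf : Measurable f)
    (hg : Measurable g) (hgE : cls g hg ∈ E.carrier)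
    (h : ∀ s : ℝ, 0 ≤ s → lam {u | s < |f u|} ≤ lam {u | s < |g u|}) :
    cls f hf ∈ E.carrier ∧ E.norm (cls f hf) ≤ E.norm (cls g hg) := by
  refine E.rearr_le _ hgE _ fun t _ => sInf_le_sInf fun s hs => ?_
  simp only [Set.mem_ofPred_eq, lam_lt_enorm_cls] at hs ⊢
  refine le_trans ?_ hs
  rcases eq_or_ne s ⊤ with rfl | hs'
  · simp
  · have key : ∀ v : ℝ, s < ‖v‖ₑ ↔ s.toReal < |v| := by
      intro v
      rw [← ofReal_norm, Real.norm_eq_abs, ENNReal.lt_ofReal_iff_toReal_lt hs']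
    simp only [key]
    exact h _ ENNReal.toReal_nonneg

theorem lam_mono_ae {s t : Set ℝ} (h : ∀ u ∈ Set.Ioo (0 : ℝ) 1, u ∈ s → u ∈ t) :
    lam s ≤ lam t := by
  rw [lam, ← restrict_Ioo_eq_restrict_Icc]
  refine measure_mono_ae ?_
  filter_upwards [ae_restrict_mem measurableSet_Ioo] with u hu using h u hu

theorem RISpace.mem_and_norm_le_of_le (E : RISpace) {f g : ℝ → ℝ} (hf : Measurable f)
    (hg : Measurable g) (hgE : cls g hg ∈ E.carrier)
    (h : ∀ u ∈ Set.Ioo (0 : ℝ) 1, |f u| ≤ |g u|) :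
    cls f hf ∈ E.carrier ∧ E.norm (cls f hf) ≤ E.norm (cls g hg) :=
  E.mem_and_norm_le hf hg hgE fun _ _ => lam_mono_ae fun u hu hs => lt_of_lt_of_le hs (h u hu)

/-- A function is dominated in distribution by any function bounding its quantiles. -/
theorem lam_lt_le_of_quantile {f g : ℝ → ℝ}
    (h : ∀ t ∈ Set.Ioo (0 : ℝ) 1, lam {u | g t < f u} ≤ ENNReal.ofReal t) (s : ℝ) :
    lam {u | s < f u} ≤ lam {u | s < g u} := by
  have hfin : lam {u | s < f u} ≤ 1 := (measure_mono (Set.subset_univ _)).trans (by simp)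
  set τ := (lam {u | s < f u}).toReal with hτ
  have hτ' : lam {u | s < f u} = ENNReal.ofReal τ :=
    (ENNReal.ofReal_toReal (hfin.trans_lt ENNReal.one_lt_top).ne).symm
  have hτ1 : τ ≤ 1 := ENNReal.toReal_le_of_le_ofReal zero_le_one (by simpa using hfin)
  -- If t < τ and g t ≤ s, then {f > s} lies in {f > g t}, of measure at most t, against the choice
  -- of τ.
  have hsub : Set.Ioo 0 τ ⊆ {u | s < g u} := by
    intro t ht
    by_contra hc
    have h1 := h t ⟨ht.1, ht.2.trans_le hτ1⟩
    have h2 : lam {u | s < f u} ≤ lam {u | g t < f u} :=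
      measure_mono fun u (hu : s < f u) => lt_of_le_of_lt (not_lt.1 hc) hu
    have h3 := h2.trans h1
    rw [hτ', ENNReal.ofReal_le_ofReal_iff ht.1.le] at h3
    exact h3.not_gt ht.2
  calc lam {u | s < f u} = lam (Set.Ioo 0 τ) := by
        rw [hτ', Measure.restrict_apply measurableSet_Ioo, Set.inter_eq_left.2, Real.volume_Ioo,
          sub_zero]
        exact Set.Ioo_subset_Icc_self.trans (Set.Icc_subset_Icc_right hτ1)
    _ ≤ _ := measure_mono hsub

end Classes

/-! ### Step functions on a uniform mesh -/

section Steps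

/-- The step function with values `b 0, b 1, …` on consecutive intervals of length `1 / m`. -/
noncomputable def step (m : ℕ) (b : ℕ → ℝ) (t : ℝ) : ℝ := b ⌊(m : ℝ) * t⌋₊

theorem measurable_step (m : ℕ) (b : ℕ → ℝ) : Measurable (step m b) :=
  (measurable_from_top (f := b)).comp (Nat.measurable_floor.comp (measurable_const_mul _))

/-- The class of a step function. -/
noncomputable def stepCls (m : ℕ) (b : ℕ → ℝ) : L0 := cls (step m b) (measurable_step m b)

theorem floor_mul_eq_iff {m : ℕ} (hm : 1 ≤ m) {t : ℝ} (ht : 0 ≤ t) (j : ℕ) :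
    ⌊(m : ℝ) * t⌋₊ = j ↔ t ∈ Set.Ico ((j : ℝ) / m) ((j + 1 : ℝ) / m) := by
  have hm' : (0 : ℝ) < m := by exact_mod_cast hm
  rw [Nat.floor_eq_iff (by positivity), Set.mem_Ico, div_le_iff₀ hm', lt_div_iff₀ hm',
    mul_comm t]

theorem floor_mul_lt {m : ℕ} (hm : 1 ≤ m) {t : ℝ} (ht : 0 ≤ t) (ht1 : t < 1) :
    ⌊(m : ℝ) * t⌋₊ < m := by
  have hm' : (0 : ℝ) < m := by exact_mod_cast hm
  rw [Nat.floor_lt (by positivity)]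
  nlinarith

theorem lam_step {m : ℕ} (hm : 1 ≤ m) (b : ℕ → ℝ) (P : ℝ → Prop) [DecidablePred P] :
    lam {u | P (step m b u)} =
      ENNReal.ofReal (((Finset.range m).filter fun j => P (b j)).card / m) := by
  have hm' : (0 : ℝ) < m := by exact_mod_cast hm
  set A := (Finset.range m).filter fun j => P (b j) with hA
  have hset : {u | P (step m b u)} ∩ Set.Ico 0 1 =
      ⋃ j ∈ A, Set.Ico ((j : ℝ) / m) ((j + 1 : ℝ) / m) := by
    ext u
    simp only [Set.mem_inter_iff, Set.mem_ofPred_eq, Set.mem_iUnion, exists_prop, hA,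
      Finset.mem_filter, Finset.mem_range]
    constructor
    · rintro ⟨h, hu⟩
      exact ⟨_, ⟨floor_mul_lt hm hu.1 hu.2, h⟩, (floor_mul_eq_iff hm hu.1 _).1 rfl⟩
    · rintro ⟨j, ⟨hj, hP⟩, hu⟩
      have hu0 : 0 ≤ u := le_trans (by positivity) hu.1
      have hu1 : u < 1 := hu.2.trans_le <| by
        rw [div_le_one hm']
        exact_mod_cast hj
      refine ⟨?_, hu0, hu1⟩
      rw [step, (floor_mul_eq_iff hm hu0 j).2 hu]
      exact hP
  -- The point 1 is dropped: the floor there is m, outside the range of indices.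
  rw [lam, ← restrict_Ico_eq_restrict_Icc, Measure.restrict_apply' measurableSet_Ico, hset,
    measure_biUnion_finset _ fun _ _ => measurableSet_Ico]
  · simp only [Real.volume_Ico, ← sub_div, add_sub_cancel_left, Finset.sum_const, nsmul_eq_mul]
    rw [div_eq_mul_one_div (A.card : ℝ), ENNReal.ofReal_mul (by positivity),
      ENNReal.ofReal_natCast]
  · intro i _ j _ hij
    refine Set.disjoint_left.2 fun u hi hj => hij ?_
    have hu0 : 0 ≤ u := le_trans (by positivity) hi.1
    rw [← (floor_mul_eq_iff hm hu0 i).2 hi, (floor_mul_eq_iff hm hu0 j).2 hj]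

theorem stepCls_sum {ι : Type*} (m : ℕ) (A : Finset ι) (b : ι → ℕ → ℝ) :
    stepCls m (fun j => ∑ r ∈ A, b r j) = ∑ r ∈ A, stepCls m (b r) := by
  classical
  induction A using Finset.induction_on with
  | empty => simp only [Finset.sum_empty]; rfl
  | insert r A hr ih =>
    rw [Finset.sum_insert hr, ← ih]
    simp only [Finset.sum_insert hr]
    rfl

end Steps

/-! ### Norm estimates in an r.i. space -/

namespace RISpace

variable (E : RISpace)

theorem norm_zero : E.norm 0 = 0 := by
  simpa using E.norm_smul 0 0 E.carrier.zero_mem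

theorem norm_nonneg {x : L0} (hx : x ∈ E.carrier) : 0 ≤ E.norm x := by
  have h1 := E.norm_add_le x hx _ (E.carrier.smul_mem (-1) hx)
  rw [E.norm_smul _ _ hx, neg_one_smul, add_neg_cancel, norm_zero, abs_neg, abs_one] at h1
  linarith

theorem norm_one_pos : 0 < E.norm 1 := by
  refine (E.norm_nonneg E.one_mem).lt_of_ne' fun h => ?_
  have h1 := E.eq_zero_of_norm 1 E.one_mem h
  have h2 : (fun _ : ℝ => (1 : ℝ)) =ᵐ[lam] fun _ => (0 : ℝ) := AEEqFun.mk_eq_mk.1 h1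
  have h3 : lam Set.univ = 0 := by
    simpa using ae_iff.1 h2
  simp at h3

theorem norm_sum_le {ι : Type*} (A : Finset ι) (x : ι → L0) (hx : ∀ r ∈ A, x r ∈ E.carrier) :
    E.norm (∑ r ∈ A, x r) ≤ ∑ r ∈ A, E.norm (x r) := by
  classical
  induction A using Finset.induction_on with
  | empty => simp [norm_zero]
  | insert r A hr ih =>
    rw [Finset.sum_insert hr, Finset.sum_insert hr]
    have hA : ∀ r ∈ A, x r ∈ E.carrier := fun s hs => hx s (Finset.mem_insert_of_mem hs)
    exact (E.norm_add_le _ (hx r (Finset.mem_insert_self r A)) _ (E.carrier.sum_mem hA)).trans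
      (add_le_add_right (ih hA) _)

theorem cls_const (c : ℝ) : cls (fun _ => c) measurable_const = c • (1 : L0) := by
  have : (fun _ : ℝ => c) = c • (fun _ : ℝ => (1 : ℝ)) := by ext; simp
  simp only [this]
  rfl

/-- Dilation of a step function increases the norm at most by the dilation factor. -/
theorem stepCls_div_mem_and_norm_le {m N : ℕ} (hm : 1 ≤ m) (hN : 1 ≤ N) {a : ℕ → ℝ}
    (ha : ∀ j, 0 ≤ a j) {g : ℝ → ℝ} (hg : Measurable g) (hgE : cls g hg ∈ E.carrier)
    (h : ∀ s : ℝ, 0 ≤ s →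
      ENNReal.ofReal (((Finset.range m).filter fun i => N * i < m ∧ s < a i).card / m) ≤
        lam {u | s < |g u|}) :
    stepCls m (fun j => a (j / N)) ∈ E.carrier ∧
      E.norm (stepCls m fun j => a (j / N)) ≤ N * E.norm (cls g hg) := by
  have hN' : 0 < N := hN
  have hm' : (0 : ℝ) < m := by exact_mod_cast hm
  -- The dilate is split by residues modulo N. Each piece carries every value of a at most once, so
  -- it is dominated in distribution by g.
  set b : ℕ → ℕ → ℝ := fun r j => if j % N = r then a (j / N) else 0 with hb
  have hsum : (fun j => a (j / N)) = fun j => ∑ r ∈ Finset.range N, b r j := by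
    ext j
    simp [hb, Nat.mod_lt j hN']
  have hpiece : ∀ r, stepCls m (b r) ∈ E.carrier ∧ E.norm (stepCls m (b r)) ≤ E.norm (cls g hg) := by
    intro r
    refine E.mem_and_norm_le _ hg hgE fun s hs => le_trans ?_ (h s hs)
    rw [lam_step hm (b r) fun v => s < |v|]
    refine ENNReal.ofReal_le_ofReal (div_le_div_of_nonneg_right ?_ hm'.le)
    rw [Nat.cast_le]
    refine Finset.card_le_card_of_injOn (fun j => j / N) ?_ ?_
    · intro j hj
      simp only [Finset.coe_filter, Finset.mem_range, Set.mem_ofPred_eq, hb] at hj ⊢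
      obtain ⟨hjm, hj⟩ := hj
      split_ifs at hj with hr
      · rw [abs_of_nonneg (ha _)] at hj
        exact ⟨(Nat.div_le_self j N).trans_lt hjm, (Nat.mul_div_le j N).trans_lt hjm, hj⟩
      · rw [abs_zero] at hj
        exact absurd hj hs.not_gt
    · intro i hi j hj hij
      simp only [Finset.coe_filter, Finset.mem_range, Set.mem_ofPred_eq, hb] at hi hj
      have key : ∀ k, s < |if k % N = r then a (k / N) else 0| → k % N = r := by
        intro k hk
        by_contra hc
        rw [if_neg hc, abs_zero] at hk
        exact hk.not_ge hs
      have hij' : i / N = j / N := hij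
      rw [← Nat.div_add_mod i N, ← Nat.div_add_mod j N, key i hi.2, key j hj.2, hij']
  rw [hsum, stepCls_sum]
  refine ⟨E.carrier.sum_mem fun r _ => (hpiece r).1,
    (E.norm_sum_le _ _ fun r _ => (hpiece r).1).trans ?_⟩
  exact (Finset.sum_le_sum fun r _ => (hpiece r).2).trans (by simp)

/-- The mean of a step function is controlled by its norm. -/
theorem sum_mul_norm_one_le {m : ℕ} (hm : 1 ≤ m) {a : ℕ → ℝ} (ha : ∀ j, 0 ≤ a j)
    (hE : stepCls m a ∈ E.carrier) :
    (∑ k ∈ Finset.range m, a k) / m * E.norm 1 ≤ E.norm (stepCls m a) := by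
  have hm' : (0 : ℝ) < m := by exact_mod_cast hm
  have hmod : ∀ r, (Finset.range m).image (fun j => (j + r) % m) = Finset.range m := by
    intro r
    refine Finset.eq_of_subset_of_card_le ?_ ?_
    · intro k hk
      obtain ⟨j, -, rfl⟩ := Finset.mem_image.1 hk
      exact Finset.mem_range.2 (Nat.mod_lt _ hm)
    · rw [Finset.card_image_of_injOn]
      intro i hi j hj hij
      have h1 : i % m = j % m := Nat.ModEq.add_right_cancel' r hij
      rwa [Nat.mod_eq_of_lt (Finset.mem_range.1 hi), Nat.mod_eq_of_lt (Finset.mem_range.1 hj)] at h1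
  have hinj : ∀ r, Set.InjOn (fun j => (j + r) % m) (Finset.range m) := fun r =>
    Finset.card_image_iff.1 (by rw [hmod])
  -- Cyclic shifts do not increase the norm, and the m of them add up to the constant ∑ a.
  have hshift : ∀ r, stepCls m (fun j => a ((j + r) % m)) ∈ E.carrier ∧
      E.norm (stepCls m fun j => a ((j + r) % m)) ≤ E.norm (stepCls m a) := by
    intro r
    refine E.mem_and_norm_le (measurable_step m _) (measurable_step m a) hE fun s _ => ?_
    rw [lam_step hm (fun j => a ((j + r) % m)) (fun v => s < |v|), lam_step hm a (fun v => s < |v|)]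
    refine ENNReal.ofReal_le_ofReal (div_le_div_of_nonneg_right ?_ hm'.le)
    rw [Nat.cast_le]
    refine Finset.card_le_card_of_injOn (fun j => (j + r) % m) ?_
      ((hinj r).mono fun j hj => Finset.mem_of_mem_filter j hj)
    intro j hj
    simp only [Finset.coe_filter, Finset.mem_range, Set.mem_ofPred_eq] at hj ⊢
    exact ⟨Nat.mod_lt _ hm, hj.2⟩
  have hconst : ∑ r ∈ Finset.range m, stepCls m (fun j => a ((j + r) % m)) =
      (∑ k ∈ Finset.range m, a k) • (1 : L0) := by
    rw [← stepCls_sum, ← cls_const, stepCls]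
    congr 1
    ext t
    simp only [step]
    conv_rhs => rw [← hmod ⌊(m : ℝ) * t⌋₊, Finset.sum_image (hinj _)]
    exact Finset.sum_congr rfl fun r _ => by rw [add_comm]
  have h1 := E.norm_sum_le (Finset.range m) (fun r => stepCls m fun j => a ((j + r) % m))
    fun r _ => (hshift r).1
  rw [hconst, E.norm_smul _ _ E.one_mem, abs_of_nonneg (Finset.sum_nonneg fun k _ => ha k)] at h1
  have h2 := h1.trans (Finset.sum_le_sum fun r _ => (hshift r).2)
  rw [Finset.sum_const, Finset.card_range, nsmul_eq_mul] at h2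
  rw [div_mul_eq_mul_div, div_le_iff₀ hm']
  linarith

end RISpace

/-! ### Distribution of `T` and the step form of `U` -/

variable {n : ℕ}

/-- The value of `T q ℓ x` on the interval that belongs to `π`. -/
noncomputable def permNorm (q : ℝ) (x : Matrix (Fin n) (Fin n) ℝ) (π : Perm (Fin n)) : ℝ :=
  (∑ i, |x i (π i)| ^ q) ^ (1 / q)

theorem T_nonneg (q : ℝ) (ℓ : Perm (Fin n) ≃ Fin n.factorial) (x : Matrix (Fin n) (Fin n) ℝ)
    (t : ℝ) : 0 ≤ T q ℓ x t :=
  Finset.sum_nonneg fun _ _ => Set.indicator_nonneg (fun _ _ => Real.rpow_nonneg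
    (Finset.sum_nonneg fun _ _ => Real.rpow_nonneg (abs_nonneg _) _) _) _

theorem T_eq_permNorm (q : ℝ) (ℓ : Perm (Fin n) ≃ Fin n.factorial)
    (x : Matrix (Fin n) (Fin n) ℝ) {t : ℝ} (ht : 0 ≤ t) {π : Perm (Fin n)}
    (hπ : ⌊(n.factorial : ℝ) * t⌋₊ = ℓ π) : T q ℓ x t = permNorm q x π := by
  have hN : 1 ≤ n.factorial := n.factorial_pos
  rw [T, Finset.sum_eq_single π]
  · rw [Set.indicator_of_mem ((floor_mul_eq_iff hN ht _).1 hπ)]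
    rfl
  · intro σ _ hσ
    refine Set.indicator_of_notMem (fun h => hσ ?_) _
    have := (floor_mul_eq_iff hN ht _).2 h
    exact ℓ.injective (Fin.ext (this.symm.trans hπ))
  · simp

theorem lam_T (q : ℝ) (ℓ : Perm (Fin n) ≃ Fin n.factorial) (x : Matrix (Fin n) (Fin n) ℝ)
    (s : ℝ) : lam {u | s < T q ℓ x u} = ENNReal.ofReal
      ((Finset.univ.filter fun π : Perm (Fin n) => s < permNorm q x π).card / n.factorial) := by
  have hN : 1 ≤ n.factorial := n.factorial_pos
  set b : ℕ → ℝ := fun j => if h : j < n.factorial then permNorm q x (ℓ.symm ⟨j, h⟩) else 0 with hb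
  have hT : ∀ u ∈ Set.Ioo (0 : ℝ) 1, T q ℓ x u = step n.factorial b u := by
    intro u hu
    have hlt := floor_mul_lt hN hu.1.le hu.2
    rw [T_eq_permNorm q ℓ x hu.1.le (π := ℓ.symm ⟨_, hlt⟩) (by simp), step, hb]
    simp only [hlt, dif_pos]
  have hset : lam {u | s < T q ℓ x u} = lam {u | s < step n.factorial b u} :=
    le_antisymm (lam_mono_ae fun u hu h => by
        change s < _ at h ⊢
        rwa [← hT u hu])
      (lam_mono_ae fun u hu h => by
        change s < _ at h ⊢
        rwa [hT u hu])
  rw [hset, lam_step hN b fun v => s < v]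
  congr 3
  rw [Finset.card_filter, Finset.card_filter, Finset.sum_range,
    ← Equiv.sum_comp ℓ fun k => if s < b k then 1 else 0]
  refine Finset.sum_congr rfl fun π _ => ?_
  simp [hb]

theorem Ucls_eq (hn : 1 ≤ n) (x : Matrix (Fin n) (Fin n) ℝ) :
    Ucls x = stepCls n (sortedEntry x) := by
  have hn' : (0 : ℝ) < n := by exact_mod_cast hn
  refine AEEqFun.mk_eq_mk.2 ?_
  -- The open intervals in `U` omit the mesh points, where `step` need not vanish; these form a null
  -- set.
  have hnull : volume (Set.range fun j : ℕ => (j : ℝ) / n) = 0 :=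
    (Set.countable_range _).measure_zero _
  rw [lam, ← restrict_Ioo_eq_restrict_Icc]
  filter_upwards [ae_restrict_mem measurableSet_Ioo,
    ae_restrict_of_ae (measure_eq_zero_iff_ae_notMem.1 hnull)] with t ht hnot
  have hlt := floor_mul_lt hn ht.1.le ht.2
  set k := ⌊(n : ℝ) * t⌋₊ with hk
  have hIco := (floor_mul_eq_iff hn ht.1.le k).1 hk.symm
  have hne : ∀ j : ℕ, (j : ℝ) / n ≠ t := fun j hj => hnot ⟨j, hj⟩
  rw [U, Finset.sum_eq_single (k + 1)]
  · rw [Set.indicator_of_mem]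
    · rfl
    · push_cast
      rw [add_sub_cancel_right]
      exact ⟨lt_of_le_of_ne hIco.1 (hne k), hIco.2⟩
  · intro j hj hjk
    refine Set.indicator_of_notMem (fun h => hjk ?_) _
    obtain ⟨i, rfl⟩ := Nat.exists_eq_add_of_le' (Finset.mem_Icc.1 hj).1
    push_cast at h
    rw [add_sub_cancel_right] at h
    rw [hk, (floor_mul_eq_iff hn ht.1.le i).2 ⟨h.1.le, h.2⟩]
  · intro h
    exact absurd (Finset.mem_Icc.2 ⟨by omega, by omega⟩) h

theorem stepCls_sortedEntry_mem (E : RISpace) (x : Matrix (Fin n) (Fin n) ℝ) :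
    stepCls n (sortedEntry x) ∈ E.carrier := by
  refine (E.mem_and_norm_le_of_le (measurable_step n (sortedEntry x))
    (measurable_const (a := sortedEntry x 0)) ?_ fun u _ => ?_).1
  · rw [RISpace.cls_const]
    exact E.carrier.smul_mem _ E.one_mem
  · rw [abs_of_nonneg (sortedEntry_nonneg x 0)]
    exact (abs_of_nonneg (sortedEntry_nonneg x _)).trans_le
      (antitone_sortedEntry x (Nat.zero_le _))

/-! ### Lower estimate -/

section Lower

theorem rpow_inv_le_permNorm {q : ℝ} (hq : 1 ≤ q)
    (x : Matrix (Fin n) (Fin n) ℝ) {v : ℝ} {π : Perm (Fin n)} (hv : v ≤ ∑ i, |x i (π i)| ^ q)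
    (hv0 : 0 ≤ v) : v ^ (1 / q) ≤ permNorm q x π :=
  Real.rpow_le_rpow hv0 hv (by positivity)

theorem abs_le_permNorm {q : ℝ} (hq : 1 ≤ q)
    (x : Matrix (Fin n) (Fin n) ℝ) (π : Perm (Fin n)) (i : Fin n) : |x i (π i)| ≤ permNorm q x π := by
  have h := rpow_inv_le_permNorm hq x (Finset.single_le_sum (f := fun i => |x i (π i)| ^ q)
    (fun i _ => Real.rpow_nonneg (abs_nonneg _) _) (Finset.mem_univ i))
    (Real.rpow_nonneg (abs_nonneg _) _)
  rwa [← Real.rpow_mul (abs_nonneg _), mul_one_div_cancel (by linarith), Real.rpow_one] at h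

/-- Paley-Zygmund at level 0 for the indicator matrix of the entries above s, of mean μ: π meets
such an entry with probability at least μ/(μ + 2), which is at least κ/3 because κ ≤ min(μ, 1). -/
theorem card_sortedEntry_le {q : ℝ} (hq : 1 ≤ q)
    (x : Matrix (Fin n) (Fin n) ℝ) (hn : 1 ≤ n) (s : ℝ) :
    n.factorial * (((Finset.range n).filter fun k => s < sortedEntry x k).card / n : ℝ) ≤
      3 * (Finset.univ.filter fun π : Perm (Fin n) => s < permNorm q x π).card := by
  have hn' : (0 : ℝ) < n := by exact_mod_cast hn
  have hfac : (0 : ℝ) ≤ n.factorial := Nat.cast_nonneg _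
  set y : Fin n → Fin n → ℝ := fun i j => if s < |x i j| then 1 else 0 with hy
  set κ : ℝ := ((Finset.range n).filter fun k => s < sortedEntry x k).card / n with hκ
  have h0 : ∀ i j, 0 ≤ y i j := fun i j => by simp only [hy]; split_ifs <;> norm_num
  have h1 : ∀ i j, y i j ≤ 1 := fun i j => by simp only [hy]; split_ifs <;> norm_num
  have hκ1 : κ ≤ 1 := by
    rw [hκ, div_le_one hn']
    exact_mod_cast (Finset.card_filter_le _ _).trans (Finset.card_range n).le
  have hκ0 : 0 ≤ κ := by positivity
  have hκm : κ ≤ mean y := by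
    rw [hκ, mean]
    refine div_le_div_of_nonneg_right ?_ hn'.le
    rw [sum_entries x fun u => if s < u then (1 : ℝ) else 0, Finset.sum_boole, Nat.cast_le]
    exact Finset.card_le_card (Finset.filter_subset_filter _
      (Finset.range_mono (Nat.le_self_pow two_ne_zero n)))
  have hcard : ((Finset.univ.filter fun π : Perm (Fin n) => 0 < diagSum y π).card : ℝ) ≤
      (Finset.univ.filter fun π : Perm (Fin n) => s < permNorm q x π).card := by
    rw [Nat.cast_le]
    refine Finset.card_le_card (Finset.monotone_filter_right _ fun π _ hπ => ?_)
    obtain ⟨i, -, hi⟩ := Finset.exists_ne_zero_of_sum_ne_zero (ne_of_gt hπ)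
    have hi' : s < |x i (π i)| := by
      by_contra hc
      exact hi (if_neg hc)
    exact hi'.trans_le (abs_le_permNorm hq x π i)
  have hPZ := card_lt_diagSum_ge hn h0 h1 le_rfl (mean_nonneg h0)
  rcases (mean_nonneg h0).eq_or_lt with hm | hm
  · rw [le_antisymm (hκm.trans hm.ge) hκ0, mul_zero]
    exact mul_nonneg zero_le_three (Nat.cast_nonneg _)
  · refine le_trans ?_ (mul_le_mul_of_nonneg_left hcard (by norm_num : (0 : ℝ) ≤ 3))
    have h2 : n.factorial * mean y ≤ (mean y + 2) *
        (Finset.univ.filter fun π : Perm (Fin n) => 0 < diagSum y π).card := by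
      refine le_of_mul_le_mul_left ?_ hm
      linarith
    refine le_of_mul_le_mul_left ?_ (by linarith : 0 < mean y + 2)
    have h3 : κ * (mean y + 2) ≤ 3 * mean y := by nlinarith
    have h4 := mul_le_mul_of_nonneg_left h3 hfac
    linarith

/-- Paley-Zygmund at half the mean μ of the truncated matrix. Its entries are at most M^q ≤ μ, so
the second moment is at most 3μ² and the probability at least (1/4)/3. -/
theorem factorial_le_card_permNorm {q : ℝ} (hq : 1 ≤ q)
    (x : Matrix (Fin n) (Fin n) ℝ) (hn : 1 ≤ n) {s : ℝ}
    (hs : s < ((sortedEntry x (n - 1) ^ q + tail q x ^ q) / 2) ^ (1 / q)) (hs0 : 0 ≤ s) :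
    (n.factorial : ℝ) ≤
      12 * (Finset.univ.filter fun π : Perm (Fin n) => s < permNorm q x π).card := by
  set M := sortedEntry x (n - 1) with hM
  set y : Fin n → Fin n → ℝ := fun i j => min |x i j| M ^ q with hy
  have hM0 : 0 ≤ M := sortedEntry_nonneg x _
  have h0 : ∀ i j, 0 ≤ y i j := fun i j => Real.rpow_nonneg (le_min (abs_nonneg _) hM0) _
  have h1 : ∀ i j, y i j ≤ M ^ q := fun i j =>
    Real.rpow_le_rpow (le_min (abs_nonneg _) hM0) (min_le_right _ _) (by linarith)
  have hmean : mean y = M ^ q + tail q x ^ q := mean_min_sortedEntry x hn hq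
  have hM1 : M ^ q ≤ mean y := by
    rw [hmean]
    linarith [Real.rpow_nonneg (tail_nonneg x q) q]
  rw [← hmean] at hs
  have hpos : 0 < mean y := by
    refine (mean_nonneg h0).lt_of_ne fun h => ?_
    rw [← h, zero_div, Real.zero_rpow (by positivity)] at hs
    exact hs.not_ge hs0
  have hPZ := card_lt_diagSum_ge hn h0 h1 (half_pos hpos).le (half_le_self hpos.le)
  have hcard : ((Finset.univ.filter fun π : Perm (Fin n) => mean y / 2 < diagSum y π).card : ℝ) ≤
      (Finset.univ.filter fun π : Perm (Fin n) => s < permNorm q x π).card := by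
    rw [Nat.cast_le]
    refine Finset.card_le_card (Finset.monotone_filter_right _ fun π _ hπ => ?_)
    refine hs.trans_le (rpow_inv_le_permNorm hq x (hπ.le.trans ?_) (half_pos hpos).le)
    exact Finset.sum_le_sum fun i _ =>
      Real.rpow_le_rpow (le_min (abs_nonneg _) hM0) (min_le_left _ _) (by linarith)
  refine le_trans ?_ (mul_le_mul_of_nonneg_left hcard (by norm_num : (0 : ℝ) ≤ 12))
  have h3 : mean y * (mean y + 2 * M ^ q) ≤ 3 * mean y ^ 2 := by nlinarith
  have h4 := hPZ.trans (mul_le_mul_of_nonneg_right h3 (Nat.cast_nonneg _))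
  refine le_of_mul_le_mul_left ?_ (by positivity : 0 < mean y ^ 2)
  nlinarith

theorem norm_stepCls_le_T {q : ℝ} (hq : 1 ≤ q)
    (x : Matrix (Fin n) (Fin n) ℝ) (E : RISpace) (hn : 1 ≤ n) (ℓ : Perm (Fin n) ≃ Fin n.factorial)
    (hT : Tcls q ℓ x ∈ E.carrier) :
    E.norm (stepCls n (sortedEntry x)) ≤ 3 * E.norm (Tcls q ℓ x) := by
  have hfac : (0 : ℝ) < n.factorial := by exact_mod_cast n.factorial_pos
  have hn' : (0 : ℝ) < n := by exact_mod_cast hn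
  -- On a mesh three times finer, Ux is the 3-fold dilate of its compression to [0, 1/3], whose
  -- distribution function is a third of that of Ux.
  have heq : stepCls n (sortedEntry x) = stepCls (n * 3) fun j => sortedEntry x (j / 3) := by
    unfold stepCls
    congr 1
    ext t
    rw [step, step, ← Nat.floor_div_natCast]
    congr 2
    push_cast
    ring
  rw [heq]
  refine (E.stepCls_div_mem_and_norm_le (by omega) (by norm_num) (sortedEntry_nonneg x)
    (measurable_T q ℓ x) hT fun s _ => ?_).2.trans (by norm_num; rfl)
  simp only [abs_of_nonneg (T_nonneg q ℓ x _)]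
  rw [lam_T]
  refine ENNReal.ofReal_le_ofReal ?_
  have hfilter : ((Finset.range (n * 3)).filter fun i => 3 * i < n * 3 ∧ s < sortedEntry x i) =
      (Finset.range n).filter fun i => s < sortedEntry x i := by
    ext i
    simp only [Finset.mem_filter, Finset.mem_range]
    constructor
    · rintro ⟨-, h1, h2⟩
      exact ⟨by omega, h2⟩
    · rintro ⟨h1, h2⟩
      exact ⟨by omega, by omega, h2⟩
  have h := card_sortedEntry_le hq x hn s
  rw [hfilter, le_div_iff₀ hfac]
  push_cast
  rw [← div_div, div_mul_eq_mul_div, div_le_iff₀ (by norm_num)]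
  linarith

theorem tail_mul_norm_one_le_T {q : ℝ} (hq : 1 ≤ q)
    (x : Matrix (Fin n) (Fin n) ℝ) (E : RISpace) (hn : 1 ≤ n) (ℓ : Perm (Fin n) ≃ Fin n.factorial)
    (hT : Tcls q ℓ x ∈ E.carrier) :
    tail q x * E.norm 1 ≤ 24 * E.norm (Tcls q ℓ x) := by
  have hfac : (0 : ℝ) < n.factorial := by exact_mod_cast n.factorial_pos
  have htq : 0 ≤ tail q x ^ q := Real.rpow_nonneg (tail_nonneg x q) q
  have hMq : 0 ≤ sortedEntry x (n - 1) ^ q := Real.rpow_nonneg (sortedEntry_nonneg x _) q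
  set c := ((sortedEntry x (n - 1) ^ q + tail q x ^ q) / 2) ^ (1 / q) with hc
  have hc0 : 0 ≤ c := by positivity
  have hconst : stepCls 12 (fun _ => c) = c • (1 : L0) := RISpace.cls_const c
  -- The constant c is the 12-fold dilate of c on [0, 1/12], which `T q ℓ x` dominates in
  -- distribution.
  have h1 : E.norm (stepCls 12 fun _ => c) ≤ 12 * E.norm (Tcls q ℓ x) := by
    refine (E.stepCls_div_mem_and_norm_le (m := 12) (N := 12) (a := fun _ => c) (by norm_num)
      (by norm_num) (fun _ => hc0) (measurable_T q ℓ x) hT fun s hs => ?_).2.trans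
      (by norm_num; rfl)
    simp only [abs_of_nonneg (T_nonneg q ℓ x _)]
    rw [lam_T]
    refine ENNReal.ofReal_le_ofReal ?_
    by_cases hsc : s < c
    · have hfilter : ((Finset.range 12).filter fun i => 12 * i < 12 ∧ s < c) = {0} := by
        ext i
        simp only [Finset.mem_filter, Finset.mem_range, Finset.mem_singleton, hsc, and_true]
        omega
      rw [hfilter, le_div_iff₀ hfac]
      have := factorial_le_card_permNorm hq x hn hsc hs
      simp only [Finset.card_singleton, Nat.cast_one, Nat.cast_ofNat]
      linarith
    · simp only [hsc, and_false, Finset.filter_false, Finset.card_empty, Nat.cast_zero, zero_div]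
      positivity
  rw [hconst, E.norm_smul _ _ E.one_mem, abs_of_nonneg hc0] at h1
  -- Since q ≥ 1, the factor 2^q absorbs the halving inside c.
  have h2 : tail q x ≤ 2 * c := by
    refine (Real.rpow_le_rpow_iff (tail_nonneg x q) (by positivity) (by linarith : 0 < q)).1 ?_
    rw [Real.mul_rpow zero_le_two hc0, hc, ← Real.rpow_mul (by positivity),
      one_div_mul_cancel (by linarith), Real.rpow_one]
    have : (2 : ℝ) ≤ 2 ^ q := by
      simpa using Real.rpow_le_rpow_of_exponent_le one_le_two hq
    nlinarith
  have h3 := mul_le_mul_of_nonneg_right h2 E.norm_one_pos.le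
  linarith

end Lower

/-! ### The power function as an element of L_p -/

section Power

/-- The power function `t ^ (-1 / m)`. -/
noncomputable def negRoot (m : ℕ) (t : ℝ) : ℝ := t ^ (-(1 / (m : ℝ)))

theorem measurable_negRoot (m : ℕ) : Measurable (negRoot m) := measurable_id.pow_const _

theorem memLp_negRoot {p : ℝ≥0∞} (hp : 0 < p) (hp' : p < ∞) {m : ℕ} (hm : p.toReal < m) :
    MemLp (cls (negRoot m) (measurable_negRoot m)) p lam := by
  have hm0 : (0 : ℝ) < m := ENNReal.toReal_nonneg.trans_lt hm
  have hae : cls (negRoot m) (measurable_negRoot m) =ᵐ[lam] negRoot m :=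
    AEEqFun.coeFn_mk _ _
  rw [memLp_congr_ae hae, ← integrable_norm_rpow_iff
    (measurable_negRoot m).aestronglyMeasurable hp.ne' hp'.ne]
  have h1 : IntegrableOn (fun t : ℝ => t ^ (-(1 / (m : ℝ)) * p.toReal)) (Set.Ioc 0 1) := by
    rw [← intervalIntegrable_iff_integrableOn_Ioc_of_le zero_le_one]
    refine intervalIntegral.intervalIntegrable_rpow' ?_
    rw [neg_mul, neg_lt_neg_iff, one_div_mul_eq_div, div_lt_one hm0]
    exact hm
  rw [lam, ← IntegrableOn, integrableOn_Icc_iff_integrableOn_Ioc]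
  refine h1.congr_fun (fun t ht => ?_) measurableSet_Ioc
  rw [negRoot, Real.norm_of_nonneg (Real.rpow_nonneg ht.1.le _), ← Real.rpow_mul ht.1.le]

end Power

/-! ### Upper estimate -/

section Upper

theorem rpow_sum_rpow_le_sum {ι : Type*} (A : Finset ι) {u : ι → ℝ} (hu : ∀ i ∈ A, 0 ≤ u i)
    {q : ℝ} (hq : 1 ≤ q) : (∑ i ∈ A, u i ^ q) ^ (1 / q) ≤ ∑ i ∈ A, u i := by
  have hq0 : 0 < q := by linarith
  have hS : 0 ≤ ∑ i ∈ A, u i := Finset.sum_nonneg hu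
  have key : ∀ v : ℝ, 0 ≤ v → v ^ q = v * v ^ (q - 1) := fun v hv => by
    rw [← Real.rpow_one_add' hv (by linarith), add_sub_cancel]
  have h : ∑ i ∈ A, u i ^ q ≤ (∑ i ∈ A, u i) ^ q := by
    rw [key _ hS, Finset.sum_mul]
    refine Finset.sum_le_sum fun i hi => ?_
    rw [key _ (hu i hi)]
    exact mul_le_mul_of_nonneg_left (Real.rpow_le_rpow (hu i hi) (Finset.single_le_sum hu hi)
      (by linarith)) (hu i hi)
  calc _ ≤ ((∑ i ∈ A, u i) ^ q) ^ (1 / q) := Real.rpow_le_rpow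
        (Finset.sum_nonneg fun i hi => Real.rpow_nonneg (hu i hi) q) h (by positivity)
    _ = _ := by rw [← Real.rpow_mul hS, mul_one_div_cancel hq0.ne', Real.rpow_one]

/-- Minkowski for the splitting of |x| at height M, with the ℓ_q norm of the excess then bounded by
its ℓ_1 norm. -/
theorem permNorm_le_add {q : ℝ} (hq : 1 ≤ q) (x : Matrix (Fin n) (Fin n) ℝ) {M : ℝ} (hM : 0 ≤ M)
    (π : Perm (Fin n)) :
    permNorm q x π ≤ diagSum (fun i j => max (|x i j| - M) 0) π +
      diagSum (fun i j => min |x i j| M ^ q) π ^ (1 / q) := by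
  have hsplit : ∀ i, |x i (π i)| = max (|x i (π i)| - M) 0 + min |x i (π i)| M := by
    intro i
    rcases le_total |x i (π i)| M with h | h
    · rw [max_eq_right (by linarith), min_eq_left h, zero_add]
    · rw [max_eq_left (by linarith), min_eq_right h, sub_add_cancel]
  calc permNorm q x π
      = (∑ i, (max (|x i (π i)| - M) 0 + min |x i (π i)| M) ^ q) ^ (1 / q) := by
        rw [permNorm]
        congr 1
        exact Finset.sum_congr rfl fun i _ => by rw [← hsplit]
    _ ≤ (∑ i, max (|x i (π i)| - M) 0 ^ q) ^ (1 / q) +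
          (∑ i, min |x i (π i)| M ^ q) ^ (1 / q) :=
        Real.Lp_add_le_of_nonneg _ hq (fun _ _ => le_max_right _ _)
          fun _ _ => le_min (abs_nonneg _) hM
    _ ≤ _ := add_le_add_left (rpow_sum_rpow_le_sum _ (fun _ _ => le_max_right _ _) hq) _

theorem rpow_add_rpow_le {u v q : ℝ} (hu : 0 ≤ u) (hv : 0 ≤ v) (hq : 1 ≤ q) :
    u ^ q + v ^ q ≤ (u + v) ^ q := by
  lift u to NNReal using hu
  lift v to NNReal using hv
  exact_mod_cast NNReal.add_rpow_le_rpow_add u v hq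

/-- The quantile bound for `T q ℓ x`. -/
theorem card_lt_permNorm_le (hn : 1 ≤ n) {q : ℝ} (hq : 1 ≤ q) (x : Matrix (Fin n) (Fin n) ℝ)
    {m : ℕ} {t : ℝ} (ht0 : 0 < t) (hm : 1 ≤ m) (ht1 : t < 1) :
    ((Finset.univ.filter fun π : Perm (Fin n) =>
        2 * m * sortedEntry x (⌊(n : ℝ) * t⌋₊ / 3) +
          3 * ((2 * m + 2) * topMean x + tail q x) * negRoot m t < permNorm q x π).card : ℝ) ≤
      t * n.factorial := by
  have hq0 : 0 < q := by linarith
  have hn' : (0 : ℝ) < n := by exact_mod_cast hn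
  have hfac : (0 : ℝ) ≤ n.factorial := Nat.cast_nonneg _
  have hm0 : m ≠ 0 := by omega
  have hm1 : (1 : ℝ) ≤ m := by exact_mod_cast hm
  -- Three exceptional events share the probability t. With this k, at most nt/3 entries exceed a,
  -- so π meets one with probability at most t/3.
  set k := ⌊(n : ℝ) * t⌋₊ / 3 with hk
  set a := sortedEntry x k with ha
  set M := sortedEntry x (n - 1) with hM
  -- Chosen so that B ^ m = 3 / t: each application of the tail bound then costs probability t/3.
  set B := negRoot m (t / 3) with hB
  have ha0 : 0 ≤ a := sortedEntry_nonneg x _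
  have hM0 : 0 ≤ M := sortedEntry_nonneg x _
  have hMμ : M ≤ topMean x := sortedEntry_le_topMean x hn
  have hτ0 := tail_nonneg x q
  have hkn : (k : ℝ) ≤ n * t / 3 := by
    have h1 : ((3 * k : ℕ) : ℝ) ≤ n * t :=
      (Nat.cast_le.2 (Nat.mul_div_le _ 3)).trans (Nat.floor_le (by positivity))
    push_cast at h1
    linarith
  have hB0 : 0 ≤ B := Real.rpow_nonneg (by positivity) _
  have hB1 : 1 ≤ B := Real.one_le_rpow_of_pos_of_le_one_of_nonpos (by positivity) (by linarith)
    (by rw [neg_nonpos]; positivity)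
  have hBm : B ^ m = 3 / t := by
    rw [hB, negRoot, ← Real.rpow_mul_natCast (by positivity), neg_mul, one_div_mul_cancel (by
      positivity), Real.rpow_neg_one, inv_div]
  have hB3 : B ≤ 3 * negRoot m t := by
    rw [hB, negRoot, negRoot, Real.div_rpow ht0.le (by norm_num), Real.rpow_neg
      (zero_le_three : (0 : ℝ) ≤ 3) (1 / (m : ℝ)), div_inv_eq_mul, mul_comm]
    refine mul_le_mul_of_nonneg_right ?_ (Real.rpow_nonneg ht0.le _)
    calc (3 : ℝ) ^ (1 / (m : ℝ)) ≤ 3 ^ (1 : ℝ) :=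
          Real.rpow_le_rpow_of_exponent_le (by norm_num) (by rw [div_le_one] <;> linarith)
      _ = 3 := Real.rpow_one 3
  set y : Fin n → Fin n → ℝ := fun i j => max (|x i j| - M) 0 with hy
  -- Cutting at a supplies the uniform bound that the tail estimate needs, and changes nothing along
  -- π outside `A₀`.
  set y₁ : Fin n → Fin n → ℝ := fun i j => min (y i j) a with hy₁
  set y₂ : Fin n → Fin n → ℝ := fun i j => min |x i j| M ^ q with hy₂
  have hy0 : ∀ i j, 0 ≤ y i j := fun _ _ => le_max_right _ _
  have hy₁0 : ∀ i j, 0 ≤ y₁ i j := fun i j => le_min (hy0 i j) ha0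
  have hy₂0 : ∀ i j, 0 ≤ y₂ i j := fun i j => Real.rpow_nonneg (le_min (abs_nonneg _) hM0) _
  have hy₂M : ∀ i j, y₂ i j ≤ M ^ q := fun i j =>
    Real.rpow_le_rpow (le_min (abs_nonneg _) hM0) (min_le_right _ _) hq0.le
  have hmean₁ : mean y₁ ≤ topMean x := by
    refine le_trans ?_ (mean_sub_sortedEntry_le x)
    exact div_le_div_of_nonneg_right (Finset.sum_le_sum fun i _ => Finset.sum_le_sum fun j _ =>
      min_le_left _ _) hn'.le
  set A₀ := Finset.univ.filter fun π : Perm (Fin n) => ∃ i, a < |x i (π i)|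
  set A₁ := Finset.univ.filter fun π : Perm (Fin n) => 2 * m * a + topMean x * B < diagSum y₁ π
  set A₂ := Finset.univ.filter fun π : Perm (Fin n) =>
    2 * m * M ^ q + (M ^ q + tail q x ^ q) * B < diagSum y₂ π
  have hA₀ : (A₀.card : ℝ) ≤ t * n.factorial / 3 := by
    have h1 := card_exists_le (fun i j => a < |x i j|) hn
    have h2 : (((Finset.univ.filter fun ij : Fin n × Fin n => a < |x ij.1 ij.2|).card : ℕ) : ℝ) ≤
        n * t / 3 := le_trans (by exact_mod_cast card_sortedEntry_lt_le x k) hkn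
    refine le_of_mul_le_mul_left (h1.trans ((mul_le_mul_of_nonneg_left h2 hfac).trans ?_)) hn'
    exact le_of_eq (by ring)
  have of_mul : ∀ c : ℝ, c * B ^ m ≤ n.factorial → c ≤ t * n.factorial / 3 := by
    intro c hc
    rw [hBm, mul_div_assoc', div_le_iff₀ ht0] at hc
    linarith
  have hA₁ := of_mul _ (card_lt_diagSum_le hn hy₁0 ha0 (fun _ _ => min_le_right _ _) hmean₁ hB0 m)
  have hA₂ := of_mul _ (card_lt_diagSum_le hn hy₂0 (Real.rpow_nonneg hM0 q) hy₂M
    (mean_min_sortedEntry x hn hq).le hB0 m)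
  have hsub : (Finset.univ.filter fun π : Perm (Fin n) => 2 * m * a +
      3 * ((2 * m + 2) * topMean x + tail q x) * negRoot m t < permNorm q x π) ⊆
      A₀ ∪ (A₁ ∪ A₂) := by
    intro π hπ
    by_contra hc
    simp only [A₀, A₁, A₂, Finset.mem_union, Finset.mem_filter, Finset.mem_univ, true_and, not_or,
      not_exists, not_lt] at hc
    obtain ⟨h₀, h₁, h₂⟩ := hc
    have h3 : diagSum y π = diagSum y₁ π := Finset.sum_congr rfl fun i _ =>
      (min_eq_left (max_le (by linarith [h₀ i]) ha0)).symm
    have h4 : diagSum y₂ π ^ (1 / q) ≤ ((2 * m + 1) * M + tail q x) * B := by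
      -- As B and 2m + 1 are at least 1, they may be replaced by their q-th powers, so that the
      -- whole bound becomes a q-th power.
      have h5 : diagSum y₂ π ≤ (((2 * m + 1) * M + tail q x) * B) ^ q := by
        have hBq : B ≤ B ^ q := by
          simpa using Real.rpow_le_rpow_of_exponent_le hB1 hq
        have hc1 : (1 : ℝ) ≤ 2 * m + 1 := by linarith
        have hcq : 2 * (m : ℝ) + 1 ≤ (2 * m + 1) ^ q := by
          simpa using Real.rpow_le_rpow_of_exponent_le hc1 hq
        have hMq := Real.rpow_nonneg hM0 q
        have hτq := Real.rpow_nonneg hτ0 q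
        calc diagSum y₂ π ≤ 2 * m * M ^ q + (M ^ q + tail q x ^ q) * B := h₂
          _ ≤ ((2 * m + 1) * M ^ q + tail q x ^ q) * B := by
              have : 2 * (m : ℝ) * M ^ q ≤ 2 * m * M ^ q * B :=
                le_mul_of_one_le_right (by positivity) hB1
              linarith
          _ ≤ ((2 * m + 1) ^ q * M ^ q + tail q x ^ q) * B ^ q := by gcongr
          _ = (((2 * m + 1) * M) ^ q + tail q x ^ q) * B ^ q := by
              rw [Real.mul_rpow (by positivity) hM0]
          _ ≤ ((2 * m + 1) * M + tail q x) ^ q * B ^ q := by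
              gcongr
              exact rpow_add_rpow_le (by positivity) hτ0 hq
          _ = _ := by rw [Real.mul_rpow (by positivity) hB0]
      have hnn : 0 ≤ ((2 * m + 1) * M + tail q x) * B := by positivity
      calc _ ≤ ((((2 * m + 1) * M + tail q x) * B) ^ q) ^ (1 / q) :=
            Real.rpow_le_rpow (diagSum_nonneg hy₂0 π) h5 (by positivity)
        _ = _ := by rw [← Real.rpow_mul hnn, mul_one_div_cancel hq0.ne', Real.rpow_one]
    have h6 := permNorm_le_add hq x hM0 π
    rw [h3] at h6
    have h7 : (topMean x + ((2 * m + 1) * M + tail q x)) * B ≤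
        ((2 * m + 2) * topMean x + tail q x) * (3 * negRoot m t) := by
      have hμ0 := hM0.trans hMμ
      refine mul_le_mul ?_ hB3 hB0 (by positivity)
      nlinarith
    have h8 := (Finset.mem_filter.1 hπ).2
    linarith
  have hcard : ((A₀ ∪ (A₁ ∪ A₂)).card : ℝ) ≤ A₀.card + (A₁.card + A₂.card) := by
    exact_mod_cast (Finset.card_union_le _ _).trans
      (Nat.add_le_add_left (Finset.card_union_le _ _) _)
  have := (Nat.cast_le (α := ℝ)).2 (Finset.card_le_card hsub)
  linarith

theorem Tcls_mem_and_norm_le (E : RISpace) (hn : 1 ≤ n) {q : ℝ} (hq : 1 ≤ q)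
    (ℓ : Perm (Fin n) ≃ Fin n.factorial) (x : Matrix (Fin n) (Fin n) ℝ) {m : ℕ} (hm : 1 ≤ m)
    (hw : cls (negRoot m) (measurable_negRoot m) ∈ E.carrier) :
    Tcls q ℓ x ∈ E.carrier ∧ E.norm (Tcls q ℓ x) ≤
      2 * m * (3 * E.norm (stepCls n (sortedEntry x))) +
        3 * ((2 * m + 2) * topMean x + tail q x) *
          E.norm (cls (negRoot m) (measurable_negRoot m)) := by
  have hfac : (0 : ℝ) < n.factorial := by exact_mod_cast n.factorial_pos
  have hn' : (0 : ℝ) < n := by exact_mod_cast hn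
  set K := 3 * ((2 * m + 2) * topMean x + tail q x) with hK
  have hK0 : 0 ≤ K := by
    have h1 := (sortedEntry_nonneg x (n - 1)).trans (sortedEntry_le_topMean x hn)
    have h2 := tail_nonneg x q
    positivity
  set d : ℕ → ℝ := fun j => sortedEntry x (j / 3) with hd
  have hU := stepCls_sortedEntry_mem E x
  have hdil : stepCls n d ∈ E.carrier ∧
      E.norm (stepCls n d) ≤ 3 * E.norm (stepCls n (sortedEntry x)) := by
    have h := E.stepCls_div_mem_and_norm_le hn (N := 3) (by norm_num) (sortedEntry_nonneg x)
      (measurable_step n (sortedEntry x)) hU fun s _ => ?_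
    · exact ⟨h.1, h.2.trans (by norm_num; rfl)⟩
    · rw [lam_step hn (sortedEntry x) (fun v => s < |v|)]
      refine ENNReal.ofReal_le_ofReal (div_le_div_of_nonneg_right ?_ hn'.le)
      rw [Nat.cast_le]
      refine Finset.card_le_card (Finset.monotone_filter_right _ fun i _ hi => ?_)
      exact hi.2.trans_le (le_abs_self _)
  -- At t this is exactly the quantile bound of `card_lt_permNorm_le`, since the first summand takes
  -- the value 2m times `sortedEntry x (⌊n t⌋₊ / 3)`.
  set G : ℝ → ℝ := (2 * m : ℝ) • step n d + K • negRoot m with hG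
  have hGmeas : Measurable G :=
    ((measurable_step n d).const_smul _).add ((measurable_negRoot m).const_smul _)
  have hGcls : cls G hGmeas =
      (2 * m : ℝ) • stepCls n d + K • cls (negRoot m) (measurable_negRoot m) := rfl
  have hGmem : cls G hGmeas ∈ E.carrier := by
    rw [hGcls]
    exact E.carrier.add_mem (E.carrier.smul_mem _ hdil.1) (E.carrier.smul_mem _ hw)
  have hT := E.mem_and_norm_le (measurable_T q ℓ x) hGmeas hGmem fun s _ => by
    simp only [abs_of_nonneg (T_nonneg q ℓ x _)]
    refine (lam_lt_le_of_quantile (f := T q ℓ x) (g := G) (fun t ht => ?_) s).trans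
      (measure_mono fun u (hu : s < G u) => hu.trans_le (le_abs_self _))
    rw [lam_T]
    exact ENNReal.ofReal_le_ofReal
      ((div_le_iff₀ hfac).2 (card_lt_permNorm_le hn hq x ht.1 hm ht.2))
  refine ⟨hT.1, hT.2.trans ?_⟩
  rw [hGcls]
  refine (E.norm_add_le _ (E.carrier.smul_mem _ hdil.1) _ (E.carrier.smul_mem _ hw)).trans ?_
  rw [E.norm_smul _ _ hdil.1, E.norm_smul _ _ hw, abs_of_nonneg hK0,
    abs_of_nonneg (by positivity : (0 : ℝ) ≤ 2 * m)]
  gcongr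
  exact hdil.2

end Upper

end RI

/-! ### Assembling the two estimates -/

theorem theorem13 (E : RI.RISpace) (p : ℝ≥0∞) (hp : 0 < p) (hp' : p < ∞)
    (hE : ∀ f : RI.L0, MemLp f p RI.lam → f ∈ E.carrier)
    (q : ℝ) (hq : 1 ≤ q) :
    E ∈ RI.F q := by
  obtain ⟨m, hpm⟩ := exists_nat_gt p.toReal
  have hm : 1 ≤ m := by
    have : (0 : ℝ) < m := ENNReal.toReal_nonneg.trans_lt hpm
    exact_mod_cast this
  have hw := hE _ (RI.memLp_negRoot hp hp' hpm)
  set W := E.norm (RI.cls (RI.negRoot m) (RI.measurable_negRoot m)) with hW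
  have hW0 : 0 ≤ W := E.norm_nonneg hw
  have h1 := E.norm_one_pos
  -- The lower constant adds the bounds for ‖Ux‖ and for the tail. The upper one adds the
  -- coefficients of ‖Ux‖ and of the tail, after the mean of Ux is replaced by ‖Ux‖ / ‖1‖.
  refine ⟨(3 + 24 / E.norm 1)⁻¹, 6 * m + 3 * (2 * m + 2) * W / E.norm 1 + 3 * W, by positivity,
    by positivity, fun n hn ℓ x => ?_⟩
  have hU := RI.stepCls_sortedEntry_mem E x
  have hU0 := E.norm_nonneg hU
  have hτ0 := RI.tail_nonneg x q
  obtain ⟨hT, hTle⟩ := RI.Tcls_mem_and_norm_le E hn hq ℓ x hm hw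
  rw [RI.Ucls_eq hn x]
  refine ⟨hT, hU, ?_, hTle.trans ?_⟩
  · have h2 := RI.norm_stepCls_le_T hq x E hn ℓ hT
    have h3 := RI.tail_mul_norm_one_le_T hq x E hn ℓ hT
    rw [← le_div_iff₀ h1, mul_div_right_comm] at h3
    rw [inv_mul_le_iff₀ (by positivity)]
    linarith
  · have h2 : RI.topMean x ≤ E.norm (RI.stepCls n (RI.sortedEntry x)) / E.norm 1 := by
      rw [le_div_iff₀ h1]
      exact E.sum_mul_norm_one_le hn (RI.sortedEntry_nonneg x) hU
    set u := E.norm (RI.stepCls n (RI.sortedEntry x)) with hu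
    calc 2 * m * (3 * u) + 3 * ((2 * m + 2) * RI.topMean x + RI.tail q x) * W
        ≤ 2 * m * (3 * u) + 3 * ((2 * m + 2) * (u / E.norm 1) + RI.tail q x) * W := by gcongr
      _ = (6 * m + 3 * (2 * m + 2) * W / E.norm 1) * u + 3 * W * RI.tail q x := by ring
      _ ≤ (6 * m + 3 * (2 * m + 2) * W / E.norm 1 + 3 * W) * (u + RI.tail q x) := by
        have : 0 ≤ (6 * m + 3 * (2 * m + 2) * W / E.norm 1) * RI.tail q x + 3 * W * u := by
          positivity
        linarith
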